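/- Let $A=\{a_1,\dots,a_m\}$ be a finite alphabet, and write $\widetilde A=A\cup A^{-1}$, where $A^{-1}$ is a disjoint set of formal inverses; extend $a\mapsto a^{-1}$ to the involution $w\mapsto w^{-1}$ of the free monoid $\widetilde A^*$ (reverse the word and invert each letter). Let $\rho_A$ be the congruence on $\widetilde A^*$ generated by all pairs $(ww^{-1}w,\,w)$ and $(uu^{-1}vv^{-1},\,vv^{-1}uu^{-1})$ with $u,v,w\in\widetilde A^*$. For a finite set $R\subseteq\widetilde A^*\times\widetilde A^*$, let $M=\mathrm{Inv}\langle A\mid R\rangle=\widetilde A^*/\tau$, where $\tau=(\rho_A\cup R)^\sharp$ is the congruence generated by $\rho_A\cup R$. For $1\le i\le m$ put $A_i=A\setminus\{a_i\}$, let $\theta_i:\widetilde A^*\to\widetilde{A_i}^*$ be the homomorphism deleting all occurrences of $a_i$ and $a_i^{-1}$, and let $M_i=\mathrm{Inv}\langle A_i\mid R_i\rangle=\widetilde{A_i}^*/\tau_i$, where $R_i=\{(r\theta_i,s\theta_i) : (r,s)\in R\}$ and $\tau_i=(\rho_{A_i}\cup R_i)^\sharp$. The eraser morphism is the monoid homomorphism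 $$\epsilon: M\to\prod_{i=1}^m M_i,\qquad (w\tau)\epsilon=\big((w\theta_1)\tau_1,\dots,(w\theta_m)\tau_m\big).$$ A monoid is finite-$\mathcal J$-above if each of its elements $v$ has only finitely many factors, i.e. elements $u$ such that $v=xuy$ for some $x,y$ in the monoid. The membership problem for a subset $L$ of a finitely generated monoid $N$ is decidable if, for every finite family of elements of $N$ (in particular, for every finite generating family), there is an algorithm which, given a word over that family, decides whether the element of $N$ represented by the word lies in $L$. **Corollary.** If $M_i$ is finite-$\mathcal J$-above for every $i=1,\dots,m$, then the membership problem is decidable for $\mathrm{Im}\,\epsilon$ in $\prod_{i=1}^m M_i$. In particular, with no further hypothesis, this holds for the presentation $\mathrm{Inv}\langle A\mid\emptyset\rangle$ of the free inverse monoid on $A$, that is, for $\epsilon:\mathrm{FIM}_A\to\prod_{i=1}^m \mathrm{FIM}_{A_i}$. -/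

import Mathlib

universe u

namespace InvPres

/-- Words over the alphabet `A ∪ A⁻¹`: the letter `(a, true)` is `a`, and `(a, false)` is `a⁻¹`. -/
abbrev Word (A : Type u) : Type u := FreeMonoid (A × Bool)

/-- The formal inverse of a word: reverse it and invert every letter. -/
def wordInv {A : Type u} (w : Word A) : Word A :=
  FreeMonoid.ofList (FreeGroup.invRev (FreeMonoid.toList w))

/-- The defining pairs of the Vagner congruence. -/
inductive VagnerRel (A : Type u) : Word A → Word A → Prop
  | inv_law (w : Word A) : VagnerRel A (w * wordInv w * w) w
  | comm_law (x y : Word A) :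
      VagnerRel A (x * wordInv x * (y * wordInv y)) (y * wordInv y * (x * wordInv x))

/-- The Vagner congruence; its quotient is the free inverse monoid on `A`. -/
def vagnerCon (A : Type u) : Con (Word A) := conGen (VagnerRel A)

/-- The congruence generated by the Vagner congruence and the relations `R`. -/
def presCon {A : Type u} (R : Set (Word A × Word A)) : Con (Word A) :=
  conGen fun x y => vagnerCon A x y ∨ (x, y) ∈ R

/-- The inverse monoid `Inv⟨A | R⟩`. -/
abbrev Presented {A : Type u} (R : Set (Word A × Word A)) : Type u := (presCon R).Quotient

/-- The alphabet `A` without the letter `a`. -/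
abbrev Rest (A : Type u) (a : A) : Type u := {b : A // b ≠ a}

/-- The homomorphism deleting all occurrences of `a` and `a⁻¹` from a word. -/
def erase {A : Type u} [DecidableEq A] (a : A) : Word A →* Word (Rest A a) :=
  FreeMonoid.lift fun l : A × Bool =>
    if h : l.1 = a then 1 else FreeMonoid.of ((⟨l.1, h⟩ : Rest A a), l.2)

/-- The relations obtained by deleting `a` and `a⁻¹` from both sides of every relation. -/
def erasedRel {A : Type u} [DecidableEq A] (R : Set (Word A × Word A)) (a : A) :
    Set (Word (Rest A a) × Word (Rest A a)) :=
  (fun r => (erase a r.1, erase a r.2)) '' R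

/-- The erased component of `Inv⟨A | R⟩` at the letter `a`. -/
abbrev Component {A : Type u} [DecidableEq A] (R : Set (Word A × Word A)) (a : A) : Type u :=
  Presented (erasedRel R a)

theorem wordInv_mul {A : Type u} (x y : Word A) : wordInv (x * y) = wordInv y * wordInv x := by
  simp [wordInv, FreeGroup.invRev]

theorem erase_wordInv {A : Type u} [DecidableEq A] (a : A) (w : Word A) :
    erase a (wordInv w) = wordInv (erase a w) := by
  induction w using FreeMonoid.inductionOn' with
  | one => rfl
  | of_mul l w ih =>
    rw [wordInv_mul, map_mul, map_mul, wordInv_mul, ih]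
    congr 1
    have h1 : wordInv (FreeMonoid.of l) = FreeMonoid.of (l.1, !l.2) := rfl
    rw [h1]
    simp only [erase, FreeMonoid.lift_eval_of]
    split_ifs <;> rfl

theorem presCon_le_ker {A : Type u} [DecidableEq A] (R : Set (Word A × Word A)) (a : A) :
    presCon R ≤ Con.ker ((presCon (erasedRel R a)).mk'.comp (erase a)) := by
  have key : vagnerCon A ≤ Con.ker ((presCon (erasedRel R a)).mk'.comp (erase a)) := by
    refine Con.conGen_le.2 ?_
    intro x y h
    refine (Con.eq _).2 (ConGen.Rel.of _ _ (Or.inl (ConGen.Rel.of _ _ ?_)))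
    cases h with
    | inv_law w =>
      simpa only [map_mul, erase_wordInv] using VagnerRel.inv_law (erase a y)
    | comm_law x y =>
      simpa only [map_mul, erase_wordInv] using VagnerRel.comm_law (erase a x) (erase a y)
  refine Con.conGen_le.2 ?_
  rintro x y (h | h)
  · exact key h
  · exact (Con.eq _).2 (ConGen.Rel.of _ _ (Or.inr ⟨(x, y), h, rfl⟩))

/-- The component of the eraser morphism at `a`: the class of `w` goes to the class of `w` with
all `a` and `a⁻¹` deleted. -/
def eraserAt {A : Type u} [DecidableEq A] (R : Set (Word A × Word A)) (a : A) :
    Presented R →* Component R a :=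
  (presCon R).lift ((presCon (erasedRel R a)).mk'.comp (erase a)) (presCon_le_ker R a)

/-- The eraser morphism into the direct product of all erased components. -/
def eraser {A : Type u} [DecidableEq A] (R : Set (Word A × Word A)) :
    Presented R →* ((a : A) → Component R a) :=
  MonoidHom.pi fun a => eraserAt R a

/-- A monoid is finite-J-above if each element `v` has only finitely many factors, that is,
elements `x` with `v = p * x * q` for some `p`, `q`. -/
def FiniteJAbove (M : Type u) [Monoid M] : Prop :=
  ∀ v : M, {x : M | ∃ p q : M, v = p * x * q}.Finite

/-- Decidability of the membership problem for a subset `L` of a finitely generated monoid `N`: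
for every finite family `g` of elements (in particular, for every finite generating family), there
is an algorithm that decides, given a word over the index set of `g`, whether the element of `N`
which it represents lies in `L`. -/
def DecidableMembership (N : Type u) [Monoid N] (L : Set N) : Prop :=
  ∀ (k : ℕ) (g : Fin k → N), ComputablePred fun w : List (Fin k) => (w.map g).prod ∈ L

end InvPres

/-!
An enumeration of rewriting derivations recognizes equality in each `M_i`, hence also membership in
the finitely generated submonoid `Im ε` of their product. For non-membership, let `v` have finitely
many factors in an inverse monoid `M`. The Wagner–Preston representation of `M` restricts to partial
bijections `x ↦ s * x` of this finite set, and `s` acts in the same way as `v` only if `s = v`.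
Finite inverse automata can be enumerated, so an element of the product outside `Im ε` is
recognized by searching for finite quotients in which its image lies outside the image of `Im ε`.

The free inverse monoid is finite-`J`-above because the Munn tree of a factor of `v` is a
translate of a subtree of the Munn tree of `v`, and an element is determined by its Munn tree
together with its image in the free group.
-/

namespace InvPres

section Semidecidable

variable {α β : Type*} [Primcodable α] [Primcodable β]

theorem rePred_exists_of_primrecPred {p : α × β → Prop} (hp : PrimrecPred p) :
    REPred fun a => ∃ b, p (a, b) := by
  classical
  let test (a : α) (n : ℕ) : Bool :=
    ((Encodable.decode n : Option β).map fun b => decide (p (a, b))).getD false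
  have test_iff (a : α) (n : ℕ) :
      test a n = true ↔ ∃ b ∈ (Encodable.decode n : Option β), p (a, b) := by
    cases h : (Encodable.decode n : Option β) <;> simp [test, h]
  have htest : Primrec₂ test :=
    Primrec.option_getD.comp
      (Primrec.option_map (Primrec.decode.comp Primrec.snd)
        (hp.decide.comp (Primrec.pair (Primrec.fst.comp Primrec.fst) Primrec.snd)))
      (Primrec.const false)
  have hsearch : Partrec₂ fun a n => (Part.some (test a n) : Part Bool) := htest.to_comp.partrec₂
  refine (Partrec.rfind hsearch).dom_re.of_eq fun a => Nat.rfind_dom.trans ⟨?_, ?_⟩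
  · rintro ⟨n, hn, -⟩
    obtain ⟨b, -, hb⟩ := (test_iff a n).1 (Part.mem_some_iff.1 hn).symm
    exact ⟨b, hb⟩
  · rintro ⟨b, hb⟩
    refine ⟨Encodable.encode b, Part.mem_some_iff.2 ?_, fun _ => trivial⟩
    exact ((test_iff a _).2 ⟨b, Encodable.encodek b, hb⟩).symm

theorem exists_primrecPred_of_rePred {p : α → Prop} (hp : REPred p) :
    ∃ q : α × ℕ → Prop, PrimrecPred q ∧ ∀ a, p a ↔ ∃ n, q (a, n) := by
  obtain ⟨c, hc⟩ := Nat.Partrec.Code.exists_code.1 hp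
  refine ⟨fun x => (c.evaln x.2 (Encodable.encode x.1)).isSome = true, ?_, fun a => ?_⟩
  · have heval : Primrec fun x : α × ℕ => c.evaln x.2 (Encodable.encode x.1) :=
      Nat.Partrec.Code.primrec_evaln.comp (Primrec.pair (Primrec.pair Primrec.snd (Primrec.const c))
        (Primrec.encode.comp Primrec.fst))
    exact Primrec.eq.comp (Primrec.option_isSome.comp heval) (Primrec.const true)
  · have hdom : p a ↔ (c.eval (Encodable.encode a)).Dom := by
      simp [hc, Part.assert]
    simp only [hdom, Part.dom_iff_mem, Nat.Partrec.Code.evaln_complete, Option.isSome_iff_exists,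
      Option.mem_def]
    exact exists_comm

theorem rePred_comp {p : β → Prop} (hp : REPred p) {f : α → β} (hf : Primrec f) :
    REPred fun a => p (f a) :=
  Partrec.comp hp hf.to_comp

theorem rePred_exists {p : α × β → Prop} (hp : REPred p) : REPred fun a => ∃ b, p (a, b) := by
  obtain ⟨q, hq, hpq⟩ := exists_primrecPred_of_rePred hp
  have hq' : PrimrecPred fun x : α × β × ℕ => q ((x.1, x.2.1), x.2.2) :=
    hq.comp (Primrec.pair (Primrec.pair Primrec.fst (Primrec.fst.comp Primrec.snd))
      (Primrec.snd.comp Primrec.snd))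
  exact (rePred_exists_of_primrecPred hq').of_eq fun a => by simp only [Prod.exists, hpq]

theorem rePred_and {p q : α → Prop} (hp : REPred p) (hq : REPred q) :
    REPred fun a => p a ∧ q a := by
  obtain ⟨p', hp', hpp'⟩ := exists_primrecPred_of_rePred hp
  obtain ⟨q', hq', hqq'⟩ := exists_primrecPred_of_rePred hq
  have h : PrimrecPred fun x : α × ℕ × ℕ => p' (x.1, x.2.1) ∧ q' (x.1, x.2.2) :=
    (hp'.comp (Primrec.pair Primrec.fst (Primrec.fst.comp Primrec.snd))).and
      (hq'.comp (Primrec.pair Primrec.fst (Primrec.snd.comp Primrec.snd)))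
  exact (rePred_exists_of_primrecPred h).of_eq fun a => by
    simp only [hpp', hqq', Prod.exists, exists_and_left, exists_and_right]

theorem rePred_or {p q : α → Prop} (hp : REPred p) (hq : REPred q) :
    REPred fun a => p a ∨ q a := by
  obtain ⟨p', hp', hpp'⟩ := exists_primrecPred_of_rePred hp
  obtain ⟨q', hq', hqq'⟩ := exists_primrecPred_of_rePred hq
  exact (rePred_exists_of_primrecPred (hp'.or hq')).of_eq fun a => by
    rw [hpp', hqq', exists_or]

theorem rePred_forall {ι : Type*} [Finite ι] {p : ι → α → Prop} (hp : ∀ i, REPred (p i)) :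
    REPred fun a => ∀ i, p i a := by
  classical
  have := Fintype.ofFinite ι
  suffices h : ∀ s : Finset ι, REPred fun a => ∀ i ∈ s, p i a from
    (h Finset.univ).of_eq fun a => by simp only [Finset.mem_univ, forall_const]
  intro s
  induction s using Finset.induction_on with
  | empty => exact (Computable.const ()).partrec.dom_re.of_eq fun a => by simp
  | insert i s _ ih => exact (rePred_and (hp i) ih).of_eq fun a => by simp

theorem rePred_reflTransGen {r : α → α → Prop} (hr : REPred fun x : α × α => r x.1 x.2) :
    REPred fun x : α × α => Relation.ReflTransGen r x.1 x.2 := by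
  classical
  obtain ⟨q, hq, hrq⟩ := exists_primrecPred_of_rePred hr
  let move (x : α) (c : α × ℕ) : α := if q ((x, c.1), c.2) then c.1 else x
  have hmove : Primrec₂ move :=
    Primrec.ite (hq.comp (Primrec.pair (Primrec.pair Primrec.fst (Primrec.fst.comp Primrec.snd))
      (Primrec.snd.comp Primrec.snd))) (Primrec.fst.comp Primrec.snd) Primrec.fst
  have move_spec (x : α) (c : α × ℕ) : Relation.ReflTransGen r x (move x c) := by
    by_cases h : q ((x, c.1), c.2)
    · simp only [move, if_pos h]
      exact .single ((hrq (x, c.1)).2 ⟨c.2, h⟩)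
    · simp only [move, if_neg h]
      exact .refl
  have foldl_spec (l : List (α × ℕ)) (x : α) : Relation.ReflTransGen r x (l.foldl move x) := by
    induction l generalizing x with
    | nil => exact .refl
    | cons c l ih => exact (move_spec x c).trans (ih _)
  have hfold : PrimrecPred fun x : (α × α) × List (α × ℕ) => x.2.foldl move x.1.1 = x.1.2 :=
    Primrec.eq.comp (Primrec.list_foldl Primrec.snd (Primrec.fst.comp Primrec.fst)
      (hmove.comp₂ (Primrec.fst.comp₂ Primrec₂.right) (Primrec.snd.comp₂ Primrec₂.right)))
      (Primrec.snd.comp Primrec.fst)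
  refine (rePred_exists_of_primrecPred hfold).of_eq fun x => ⟨?_, fun h => ?_⟩
  · rintro ⟨l, hl : l.foldl move x.1 = x.2⟩
    exact hl ▸ foldl_spec l x.1
  · obtain ⟨x, y⟩ := x
    induction (show Relation.ReflTransGen r x y from h) with
    | refl => exact ⟨[], rfl⟩
    | @tail y z _ hyz ih =>
      obtain ⟨l, hl : l.foldl move x = y⟩ := ih ‹_›
      obtain ⟨n, hn⟩ := (hrq (y, z)).1 hyz
      refine ⟨l ++ [(z, n)], ?_⟩
      simp only [List.foldl_append, List.foldl_cons, List.foldl_nil, hl, move, if_pos hn]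

end Semidecidable

section Membership

variable {α β N : Type*} [Monoid N]

theorem prod_map_flatMap (g : α → N) (u : β → List α) (w : List β) :
    ((w.flatMap u).map g).prod = (w.map fun b => ((u b).map g).prod).prod := by
  simp only [List.flatMap, List.map_flatten, List.prod_flatten, List.map_map, Function.comp_def]

theorem prod_map_apply {ι : Type*} {N : ι → Type*} [∀ i, Monoid (N i)] (g : α → ∀ i, N i)
    (w : List α) (i : ι) :
    (w.map g).prod i = (w.map fun a => g a i).prod :=
  (map_list_prod (Pi.evalMonoidHom N i) (w.map g)).trans (by rw [List.map_map]; rfl)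

theorem mem_closure_range_iff_exists_list {h : β → N} {v : N} :
    v ∈ Submonoid.closure (Set.range h) ↔ ∃ x : List β, (x.map h).prod = v := by
  rw [← FreeMonoid.mrange_lift, MonoidHom.mem_mrange]
  exact exists_congr fun x => by rw [FreeMonoid.lift_apply]; rfl

theorem exists_list_forall_exists_con (D : Con N) [Finite D.Quotient] (h : β → N) :
    ∃ K : List (List β), ∀ x : List β, ∃ k ∈ K, D (x.map h).prod (k.map h).prod := by
  have := Fintype.ofFinite D.Quotient
  let cls (x : List β) : D.Quotient := ((x.map h).prod : N)
  refine ⟨Finset.univ.toList.map (Function.invFun cls), fun x =>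
    ⟨Function.invFun cls (cls x), ?_, ?_⟩⟩
  · exact List.mem_map_of_mem (Finset.mem_toList.2 (Finset.mem_univ _))
  · exact (Con.eq _).1 (Function.invFun_eq (f := cls) ⟨x, rfl⟩).symm

theorem forall_exists_con_of_closed {D : Con N} {h : β → N} {K : List (List β)}
    (hnil : ∃ k ∈ K, D (([] : List β).map h).prod (k.map h).prod)
    (hstep : ∀ b, ∀ k ∈ K, ∃ k' ∈ K, D ((k ++ [b]).map h).prod (k'.map h).prod) (x : List β) :
    ∃ k ∈ K, D (x.map h).prod (k.map h).prod := by
  induction x using List.reverseRecOn with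
  | nil => exact hnil
  | append_singleton x b ih =>
    obtain ⟨k, hk, hxk⟩ := ih
    obtain ⟨k', hk', hkk'⟩ := hstep b k hk
    refine ⟨k', hk', D.trans ?_ hkk'⟩
    simpa only [List.map_append, List.prod_append] using D.mul hxk (D.refl _)

variable [Primcodable α] [Primcodable β]

theorem primrecPred_forall {ι : Type*} [Finite ι] {p : ι → α → Prop}
    (hp : ∀ i, PrimrecPred (p i)) : PrimrecPred fun a => ∀ i, p i a := by
  classical
  have := Fintype.ofFinite ι
  suffices h : ∀ s : Finset ι, PrimrecPred fun a => ∀ i ∈ s, p i a from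
    (h Finset.univ).of_eq fun a => by simp only [Finset.mem_univ, forall_const]
  intro s
  induction s using Finset.induction_on with
  | empty => exact ⟨fun _ => isTrue (by simp), (Primrec.const true).of_eq fun a => by simp⟩
  | insert i s _ ih => exact ((hp i).and ih).of_eq fun a => by simp

/-- The word problem for the finite family `g` is semidecidable. -/
def SemidecidableEq (g : α → N) : Prop :=
  REPred fun p : List α × List α => (p.1.map g).prod = (p.2.map g).prod

/-- An effective form of Golubov's complete separability: there is a sequence of congruences of
finite index, decidable on the words over the family `g`, such that each element of the monoid is
alone in its class for one of them. -/
def EffectivelyCompletelySeparable (g : α → N) : Prop :=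
  ∃ D : ℕ → Con N, (∀ n, Finite (D n).Quotient) ∧ (∀ v, ∃ n, ∀ x, D n v x → v = x) ∧
    PrimrecPred fun p : ℕ × List α × List α => D p.1 (p.2.1.map g).prod (p.2.2.map g).prod

theorem primrec_flatMap_of_finite [Finite β] (u : β → List α) :
    Primrec fun w : List β => w.flatMap u :=
  Primrec.list_flatMap .id ((Primrec.dom_finite u).comp₂ Primrec₂.right)

theorem SemidecidableEq.of_words [Finite β] {g : α → N} (hg : SemidecidableEq g)
    {g' : β → N} (u : β → List α) (hu : ∀ b, ((u b).map g).prod = g' b) : SemidecidableEq g' := by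
  obtain rfl : (fun b => ((u b).map g).prod) = g' := funext hu
  have hu' := primrec_flatMap_of_finite u
  refine (rePred_comp hg (Primrec.pair (hu'.comp .fst) (hu'.comp .snd))).of_eq fun p => ?_
  simp only [prod_map_flatMap]

theorem EffectivelyCompletelySeparable.of_words [Finite β] {g : α → N}
    (hg : EffectivelyCompletelySeparable g) {g' : β → N} (u : β → List α)
    (hu : ∀ b, ((u b).map g).prod = g' b) : EffectivelyCompletelySeparable g' := by
  obtain rfl : (fun b => ((u b).map g).prod) = g' := funext hu
  have hu' := primrec_flatMap_of_finite u
  obtain ⟨D, hfin, hsep, hD⟩ := hg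
  refine ⟨D, hfin, hsep, (hD.comp (Primrec.pair .fst (Primrec.pair (hu'.comp (.comp .fst .snd))
    (hu'.comp (.comp .snd .snd))))).of_eq fun p => ?_⟩
  simp only [prod_map_flatMap]

theorem effectivelyCompletelySeparable_of_codes {γ : Type*} [Primcodable γ] {g : α → N}
    (D : γ → Con N) (hfin : ∀ c, Finite (D c).Quotient) (hsep : ∀ v, ∃ c, ∀ x, D c v x → v = x)
    (hD : PrimrecPred fun p : γ × List α × List α =>
      D p.1 (p.2.1.map g).prod (p.2.2.map g).prod) : EffectivelyCompletelySeparable g := by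
  classical
  let D' (n : ℕ) : Con N := (Encodable.decode n : Option γ).elim ⊤ D
  refine ⟨D', fun n => ?_, fun v => ?_, ?_⟩
  · cases h : (Encodable.decode n : Option γ) with
    | none =>
      have : Subsingleton (⊤ : Con N).Quotient :=
        ⟨fun x y => Con.induction_on₂ x y fun _ _ => (Con.eq _).2 trivial⟩
      simp only [D', h, Option.elim_none]
      infer_instance
    | some c => simpa only [D', h, Option.elim_some] using hfin c
  · obtain ⟨c, hc⟩ := hsep v
    exact ⟨Encodable.encode c, by simpa only [D', Encodable.encodek, Option.elim_some] using hc⟩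
  · refine Primrec.primrecPred (p := fun p : ℕ × List α × List α => _) ((Primrec.option_getD.comp
      (Primrec.option_map (Primrec.decode.comp Primrec.fst)
        (hD.decide.comp₂ (Primrec₂.pair.comp₂ Primrec₂.right (Primrec.snd.comp₂ Primrec₂.left))))
      (Primrec.const true)).of_eq fun p => ?_)
    have htop (x y : N) : (⊤ : Con N) x y := trivial
    cases h : (Encodable.decode p.1 : Option γ) <;> simp [D', h, htop]

section Pi

variable {ι : Type*} [Finite ι] {N : ι → Type*} [∀ i, Monoid (N i)] {g : α → ∀ i, N i}

theorem SemidecidableEq.pi (hg : ∀ i, SemidecidableEq fun a => g a i) : SemidecidableEq g :=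
  (rePred_forall hg).of_eq fun p => by simp only [funext_iff, prod_map_apply]

theorem EffectivelyCompletelySeparable.pi
    (hg : ∀ i, EffectivelyCompletelySeparable fun a => g a i) :
    EffectivelyCompletelySeparable g := by
  choose D hfin hsep hD using hg
  obtain ⟨m, ⟨e⟩⟩ := Finite.exists_equiv_fin ι
  refine effectivelyCompletelySeparable_of_codes (γ := Fin m → ℕ)
    (fun c => Con.pi fun i => D i (c (e i))) (fun c => ?_) (fun v => ?_) ?_
  · let toQuotients (x : (Con.pi fun i => D i (c (e i))).Quotient) (i : ι) :
        (D i (c (e i))).Quotient :=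
      Con.liftOn x (fun y => (y i : (D i (c (e i))).Quotient)) fun _ _ h => (Con.eq _).2 (h i)
    refine Finite.of_injective toQuotients fun x y => ?_
    induction x, y using Con.induction_on₂ with
    | H x y => exact fun h => (Con.eq _).2 fun i => (Con.eq _).1 (congrFun h i)
  · choose n hn using fun i => hsep i (v i)
    refine ⟨fun j => n (e.symm j), fun x hx => funext fun i => hn i (x i) ?_⟩
    have hxi : D i (n (e.symm (e i))) (v i) (x i) := hx i
    rwa [e.symm_apply_apply] at hxi
  · refine (primrecPred_forall fun i => (hD i).comp (Primrec.pair
      (Primrec.fin_app.comp .fst (.const (e i))) .snd)).of_eq fun p => ?_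
    simp only [← prod_map_apply]
    rfl

end Pi

theorem primrecRel_con_map {γ : Type*} [Primcodable γ] {D : ℕ → Con N} {f : γ → N}
    (hD : PrimrecPred fun p : ℕ × List γ × List γ => D p.1 (p.2.1.map f).prod (p.2.2.map f).prod)
    {s : α → γ} {t : β → γ} (hs : Primrec s) (ht : Primrec t) :
    PrimrecRel fun (k : List β) (p : ℕ × List α) =>
      D p.1 (p.2.map (f ∘ s)).prod (k.map (f ∘ t)).prod :=
  (hD.comp (Primrec.pair (.comp .fst .snd) (Primrec.pair
    (Primrec.list_map (.comp .snd .snd) (hs.comp₂ Primrec₂.right))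
    (Primrec.list_map .fst (ht.comp₂ Primrec₂.right))))).of_eq fun p => by
      simp only [List.map_map]

theorem rePred_mem_closure_range {g : α → N} {h : β → N}
    (heq : SemidecidableEq (Sum.elim g h)) :
    REPred fun w : List α => (w.map g).prod ∈ Submonoid.closure (Set.range h) := by
  have heq' : REPred fun p : List α × List β => (p.2.map h).prod = (p.1.map g).prod :=
    (rePred_comp heq (Primrec.pair
      (Primrec.list_map Primrec.snd (Primrec.sumInr.comp₂ Primrec₂.right))
      (Primrec.list_map Primrec.fst (Primrec.sumInl.comp₂ Primrec₂.right)))).of_eq fun p => by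
        simp only [List.map_map, Sum.elim_comp_inl, Sum.elim_comp_inr]
  exact (rePred_exists heq').of_eq fun w => by rw [mem_closure_range_iff_exists_list]

/-- A certificate `(n, K)` for `v ∉ closure (range h)` consists of a congruence `D n` and words `K`
whose `D n`-classes exhaust those of the submonoid and do not contain `v`. -/
theorem rePred_notMem_closure_range [Finite β] {g : α → N} {h : β → N}
    (hsep : EffectivelyCompletelySeparable (Sum.elim g h)) :
    REPred fun w : List α => (w.map g).prod ∉ Submonoid.closure (Set.range h) := by
  obtain ⟨D, hfin, hsep, hD⟩ := hsep
  have hgh : PrimrecRel fun (k : List β) (p : ℕ × List α) =>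
      D p.1 (p.2.map g).prod (k.map h).prod :=
    primrecRel_con_map hD Primrec.sumInl Primrec.sumInr
  have hhh : PrimrecRel fun (k : List β) (p : ℕ × List β) =>
      D p.1 (p.2.map h).prod (k.map h).prod :=
    primrecRel_con_map hD Primrec.sumInr Primrec.sumInr
  have hnil : PrimrecPred fun c : ℕ × List (List β) =>
      ∃ k ∈ c.2, D c.1 (([] : List β).map h).prod (k.map h).prod :=
    hhh.exists_mem_list.comp .snd (Primrec.pair .fst (.const []))
  have hstep (b : β) : PrimrecPred fun c : ℕ × List (List β) =>
      ∀ k ∈ c.2, ∃ k' ∈ c.2, D c.1 ((k ++ [b]).map h).prod (k'.map h).prod := by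
    refine PrimrecRel.comp (PrimrecRel.forall_mem_list
      (R := fun (k : List β) (c : ℕ × List (List β)) =>
        ∃ k' ∈ c.2, D c.1 ((k ++ [b]).map h).prod (k'.map h).prod) ?_) .snd .id
    exact hhh.exists_mem_list.comp (.comp .snd .snd) (Primrec.pair (.comp .fst .snd)
      (Primrec.list_append.comp .fst (.const [b])))
  have havoid : PrimrecPred fun x : List α × ℕ × List (List β) =>
      ¬ ∃ k ∈ x.2.2, D x.2.1 (x.1.map g).prod (k.map h).prod :=
    (hgh.exists_mem_list.comp (.comp .snd .snd) (Primrec.pair (.comp .fst .snd) .fst)).not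
  refine (rePred_exists_of_primrecPred (((hnil.comp .snd).and
    ((primrecPred_forall hstep).comp .snd)).and havoid)).of_eq fun w => ?_
  rw [mem_closure_range_iff_exists_list]
  constructor
  · rintro ⟨⟨n, K⟩, ⟨hn, hs⟩, ha⟩ ⟨x, hx⟩
    obtain ⟨k, hk, hxk⟩ := forall_exists_con_of_closed hn hs x
    exact ha ⟨k, hk, hx ▸ hxk⟩
  · intro hw
    obtain ⟨n, hn⟩ := hsep (w.map g).prod
    have := hfin n
    obtain ⟨K, hK⟩ := exists_list_forall_exists_con (D n) h
    exact ⟨(n, K), ⟨hK [], fun b k _ => hK (k ++ [b])⟩,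
      fun ⟨k, _, hk⟩ => hw ⟨k, (hn _ hk).symm⟩⟩

theorem decidableMembership_closure {N : Type u} [Monoid N]
    (heq : ∀ {k m : ℕ} (f : Fin k ⊕ Fin m → N), SemidecidableEq f)
    (hsep : ∀ {k m : ℕ} (f : Fin k ⊕ Fin m → N), EffectivelyCompletelySeparable f)
    {F : Set N} (hF : F.Finite) : DecidableMembership N (Submonoid.closure F) := by
  intro k g
  obtain ⟨m, h, -, rfl⟩ := hF.fin_param
  exact ComputablePred.computable_iff_re_compl_re'.2
    ⟨rePred_mem_closure_range (heq (Sum.elim g h)),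
      rePred_notMem_closure_range (hsep (Sum.elim g h))⟩

end Membership

section WordProblem

/-- One application, inside a context, of a rule from `r` or of its reverse. -/
def Rewrites {M : Type*} [Mul M] (r : M → M → Prop) (x y : M) : Prop :=
  ∃ p u v q, (r u v ∨ r v u) ∧ x = p * u * q ∧ y = p * v * q

theorem conGen_iff_reflTransGen_rewrites {M : Type*} [Monoid M] {r : M → M → Prop} {x y : M} :
    conGen r x y ↔ Relation.ReflTransGen (Rewrites r) x y := by
  have : Std.Symm (Rewrites r) := ⟨fun x y ⟨p, u, v, q, h, hx, hy⟩ => ⟨p, v, u, q, h.symm, hy, hx⟩⟩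
  have hleft (a : M) ⦃x y : M⦄ : Rewrites r x y → Rewrites r (a * x) (a * y) := by
    rintro ⟨p, u, v, q, h, rfl, rfl⟩
    exact ⟨a * p, u, v, q, h, by simp only [mul_assoc], by simp only [mul_assoc]⟩
  have hright (a : M) ⦃x y : M⦄ : Rewrites r x y → Rewrites r (x * a) (y * a) := by
    rintro ⟨p, u, v, q, h, rfl, rfl⟩
    exact ⟨p, u, v, q * a, h, by simp only [mul_assoc], by simp only [mul_assoc]⟩
  let rewriteCon : Con M :=
    { r := Relation.ReflTransGen (Rewrites r)
      iseqv := ⟨fun _ => .refl, fun h => symm h, .trans⟩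
      mul' := fun {w x y z} hwx hyz =>
        (hwx.lift (· * y) (hright y)).trans (hyz.lift (x * ·) (hleft x)) }
  have hle : conGen r ≤ rewriteCon := Con.conGen_le.2 fun u v h =>
    .single ⟨1, u, v, 1, .inl h, by simp only [one_mul, mul_one], by simp only [one_mul, mul_one]⟩
  refine ⟨fun h => hle h, fun h => ?_⟩
  induction h with
  | refl => exact (conGen r).refl x
  | tail _ hyz ih =>
    obtain ⟨p, u, v, q, h, rfl, rfl⟩ := hyz
    have huv : conGen r u v :=
      h.elim (ConGen.Rel.of _ _) fun h => (conGen r).symm (ConGen.Rel.of _ _ h)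
    exact (conGen r).trans ih ((conGen r).mul ((conGen r).mul ((conGen r).refl p) huv)
      ((conGen r).refl q))

theorem rePred_conGen {M : Type*} [Monoid M] [Primcodable M]
    (hmul : Primrec₂ fun x y : M => x * y) {r : M → M → Prop}
    (hr : REPred fun p : M × M => r p.1 p.2) : REPred fun p : M × M => conGen r p.1 p.2 := by
  have hcontext {f : M × M × M × M → M} (hf : Primrec f) :
      Primrec fun c : (M × M) × (M × M × M × M) => c.2.1 * f c.2 * c.2.2.2.2 :=
    hmul.comp (hmul.comp (.comp .fst .snd) (hf.comp .snd))
      (.comp .snd (.comp .snd (.comp .snd .snd)))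
  have hu : Primrec fun c : M × M × M × M => c.2.1 := .comp .fst .snd
  have hv : Primrec fun c : M × M × M × M => c.2.2.1 := .comp .fst (.comp .snd .snd)
  have hrule : REPred fun c : (M × M) × (M × M × M × M) =>
      r c.2.2.1 c.2.2.2.1 ∨ r c.2.2.2.1 c.2.2.1 :=
    rePred_or (rePred_comp hr (Primrec.pair (hu.comp .snd) (hv.comp .snd)))
      (rePred_comp hr (Primrec.pair (hv.comp .snd) (hu.comp .snd)))
  have hends : PrimrecPred fun c : (M × M) × (M × M × M × M) =>
      c.1.1 = c.2.1 * c.2.2.1 * c.2.2.2.2 ∧ c.1.2 = c.2.1 * c.2.2.2.1 * c.2.2.2.2 :=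
    (Primrec.eq.comp (.comp .fst .fst) (hcontext hu)).and
      (Primrec.eq.comp (.comp .snd .fst) (hcontext hv))
  have hstep : REPred fun p : M × M => Rewrites r p.1 p.2 :=
    (rePred_exists (rePred_and hrule hends.computablePred.to_re)).of_eq fun p => by
      simp only [Rewrites, Prod.exists]
  exact (rePred_reflTransGen hstep).of_eq fun p => conGen_iff_reflTransGen_rewrites.symm

instance primcodableFreeMonoid {α : Type*} [Primcodable α] : Primcodable (FreeMonoid α) :=
  inferInstanceAs (Primcodable (List α))

theorem primrec_freeMonoid_mul {α : Type*} [Primcodable α] :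
    Primrec₂ fun x y : FreeMonoid α => x * y :=
  Primrec.list_append (α := α)

variable {A : Type u}

theorem vagnerRel_iff {x y : Word A} : VagnerRel A x y ↔
    (∃ w, w * wordInv w * w = x ∧ w = y) ∨
      ∃ c : Word A × Word A, c.1 * wordInv c.1 * (c.2 * wordInv c.2) = x ∧
        c.2 * wordInv c.2 * (c.1 * wordInv c.1) = y := by
  constructor
  · rintro (_ | ⟨u, v⟩)
    exacts [.inl ⟨y, rfl, rfl⟩, .inr ⟨(u, v), rfl, rfl⟩]
  · rintro (⟨w, rfl, rfl⟩ | ⟨c, rfl, rfl⟩)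
    exacts [.inv_law w, .comm_law c.1 c.2]

theorem primrec_wordInv [Primcodable A] : Primrec (wordInv : Word A → Word A) :=
  Primrec.list_reverse.comp (Primrec.list_map (α := List (A × Bool)) Primrec.id
    ((Primrec.pair .fst (Primrec.not.comp .snd)).comp₂ Primrec₂.right))

theorem rePred_vagnerRel [Primcodable A] :
    REPred fun p : Word A × Word A => VagnerRel A p.1 p.2 := by
  have hmul := primrec_freeMonoid_mul (α := A × Bool)
  have hidem {γ : Type u} [Primcodable γ] {f : γ → Word A} (hf : Primrec f) :
      Primrec fun c => f c * wordInv (f c) := hmul.comp hf (primrec_wordInv.comp hf)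
  have hinv : PrimrecPred fun c : (Word A × Word A) × Word A =>
      c.2 * wordInv c.2 * c.2 = c.1.1 ∧ c.2 = c.1.2 :=
    (Primrec.eq.comp (hmul.comp (hidem .snd) .snd) (.comp .fst .fst)).and
      (Primrec.eq.comp .snd (.comp .snd .fst))
  have hx : Primrec fun c : (Word A × Word A) × (Word A × Word A) => c.2.1 := .comp .fst .snd
  have hy : Primrec fun c : (Word A × Word A) × (Word A × Word A) => c.2.2 := .comp .snd .snd
  have hcomm : PrimrecPred fun c : (Word A × Word A) × (Word A × Word A) =>
      c.2.1 * wordInv c.2.1 * (c.2.2 * wordInv c.2.2) = c.1.1 ∧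
        c.2.2 * wordInv c.2.2 * (c.2.1 * wordInv c.2.1) = c.1.2 :=
    (Primrec.eq.comp (hmul.comp (hidem hx) (hidem hy)) (.comp .fst .fst)).and
      (Primrec.eq.comp (hmul.comp (hidem hy) (hidem hx)) (.comp .snd .fst))
  exact (rePred_or (rePred_exists_of_primrecPred hinv) (rePred_exists_of_primrecPred hcomm)).of_eq
    fun p => by rw [vagnerRel_iff]

theorem rePred_presCon [Primcodable A] {R : Set (Word A × Word A)}
    (hR : REPred fun p : Word A × Word A => p ∈ R) :
    REPred fun p : Word A × Word A => presCon R p.1 p.2 :=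
  rePred_conGen primrec_freeMonoid_mul
    (rePred_or (rePred_conGen primrec_freeMonoid_mul rePred_vagnerRel) hR)

theorem primrecPred_mem_of_finite {α : Type*} [Primcodable α] {S : Set α} (hS : S.Finite) :
    PrimrecPred fun a => a ∈ S := by
  have hmem := (Primrec.eq (α := α)).exists_mem_list.comp (.const hS.toFinset.toList) .id
  exact hmem.of_eq fun a => by simp

/-- The element of `Inv⟨A | R⟩` represented by a letter. -/
def letter (R : Set (Word A × Word A)) (l : A × Bool) : Presented R :=
  (FreeMonoid.of l : Word A)

theorem prod_map_letter (R : Set (Word A × Word A)) (w : List (A × Bool)) :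
    (w.map (letter R)).prod = ((FreeMonoid.ofList w : Word A) : Presented R) := by
  induction w with
  | nil => rfl
  | cons l w ih => rw [List.map_cons, List.prod_cons, ih]; rfl

theorem exists_words {α : Type*} {R : Set (Word A × Word A)} (g : α → Presented R) :
    ∃ u : α → List (A × Bool), ∀ a, ((u a).map (letter R)).prod = g a := by
  choose u hu using fun a => Con.mk'_surjective (g a)
  exact ⟨fun a => FreeMonoid.toList (u a), fun a => (prod_map_letter R _).trans (hu a)⟩

theorem range_eq_closure_letter {R : Set (Word A × Word A)} {N : Type*} [Monoid N]
    (φ : Presented R →* N) :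
    Set.range φ = Submonoid.closure (Set.range (φ ∘ letter R)) := by
  rw [← FreeMonoid.mrange_lift, ← MonoidHom.coe_mrange]
  have hlift : FreeMonoid.lift (φ ∘ letter R) = φ.comp (presCon R).mk' :=
    FreeMonoid.hom_eq fun _ => rfl
  rw [hlift, MonoidHom.mrange_comp]
  have hsurj : MonoidHom.mrange (presCon R).mk' = ⊤ :=
    MonoidHom.mrange_eq_top.2 Con.mk'_surjective
  rw [hsurj, MonoidHom.mrange_eq_map]

theorem semidecidableEq_letter [Primcodable A] {R : Set (Word A × Word A)}
    (hR : REPred fun p : Word A × Word A => p ∈ R) : SemidecidableEq (letter R) :=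
  (rePred_presCon hR).of_eq fun p => by
    rw [prod_map_letter, prod_map_letter]
    exact (Con.eq _).symm

end WordProblem

section InverseMonoids

/-- An inverse monoid, defined by the Vagner laws: every element has a unique generalized
inverse `x⁻¹`. -/
class InverseMonoid (M : Type*) extends Monoid M, InvolutiveInv M where
  protected mul_inv_rev (x y : M) : (x * y)⁻¹ = y⁻¹ * x⁻¹
  protected mul_inv_mul_self (x : M) : x * x⁻¹ * x = x
  mul_inv_comm (x y : M) : x * x⁻¹ * (y * y⁻¹) = y * y⁻¹ * (x * x⁻¹)

open InverseMonoid (mul_inv_comm)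

theorem inv_mul_comm {M : Type*} [InverseMonoid M] (x y : M) :
    x⁻¹ * x * (y⁻¹ * y) = y⁻¹ * y * (x⁻¹ * x) := by
  simpa only [inv_inv] using mul_inv_comm x⁻¹ y⁻¹

theorem inv_mul_mul_inv_comm {M : Type*} [InverseMonoid M] (x y : M) :
    x⁻¹ * x * (y * y⁻¹) = y * y⁻¹ * (x⁻¹ * x) := by
  simpa only [inv_inv] using mul_inv_comm x⁻¹ y

theorem inv_mul_inv_self {M : Type*} [InverseMonoid M] (x : M) : x⁻¹ * x * x⁻¹ = x⁻¹ := by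
  simpa only [inv_inv] using InverseMonoid.mul_inv_mul_self x⁻¹

theorem mul_inv_mul_eq {M : Type*} [InverseMonoid M] (x y : M) :
    x * (x⁻¹ * y) = y * ((x⁻¹ * y)⁻¹ * (x⁻¹ * y)) :=
  calc x * (x⁻¹ * y) = x * x⁻¹ * (y * y⁻¹) * y := by
        rw [mul_assoc _ _ y, InverseMonoid.mul_inv_mul_self, mul_assoc]
    _ = y * ((x⁻¹ * y)⁻¹ * (x⁻¹ * y)) := by
        rw [mul_inv_comm, InverseMonoid.mul_inv_rev, inv_inv]
        simp only [mul_assoc]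

theorem eq_of_generalized_inverses {T : Type*} [Monoid T] {m s t : T} (hm : m * s * m = m)
    (hs : s * m * s = s) (hm' : m * t * m = m) (ht : t * m * t = t)
    (hcomm : m * s * (m * t) = m * t * (m * s)) (hcomm' : s * m * (t * m) = t * m * (s * m)) :
    s = t :=
  calc s = s * (m * t * m) * s := by rw [hm', hs]
    _ = s * m * (t * m) * s := by simp only [mul_assoc]
    _ = t * m * (s * m * s) := by rw [hcomm']; simp only [mul_assoc]
    _ = t * m * s := by rw [hs]
    _ = t * m * t * (m * s) := by rw [ht]; simp only [mul_assoc]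
    _ = t * (m * s * (m * t)) := by rw [hcomm]; simp only [mul_assoc]
    _ = t * (m * s * m) * t := by simp only [mul_assoc]
    _ = t := by rw [hm, ht]

/-- The symmetric inverse monoid on `σ`, acting from the left: `f * g` applies `g` first. -/
instance symmetricInverseMonoid {σ : Type*} : InverseMonoid (σ ≃. σ) where
  one := PEquiv.refl σ
  mul f g := g.trans f
  inv f := f.symm
  mul_assoc f g h := (PEquiv.trans_assoc h g f).symm
  one_mul := PEquiv.trans_refl
  mul_one := PEquiv.refl_trans
  inv_inv := PEquiv.symm_symm
  mul_inv_rev f g := PEquiv.symm_trans_rev g f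
  mul_inv_mul_self f := by
    change f.trans (f.symm.trans f) = f
    ext a b
    simp only [PEquiv.trans_eq_some, PEquiv.eq_some_iff]
    grind
  mul_inv_comm f g := by
    change (g.symm.trans g).trans (f.symm.trans f) = (f.symm.trans f).trans (g.symm.trans g)
    ext a b
    simp only [PEquiv.trans_eq_some, PEquiv.eq_some_iff]
    grind

theorem mul_apply_eq {σ : Type*} (f g : σ ≃. σ) (p : σ) : (f * g) p = (g p).bind f := rfl

theorem wordInv_wordInv {A : Type u} (w : Word A) : wordInv (wordInv w) = w :=
  FreeGroup.invRev_invRev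

variable {A : Type u} {R : Set (Word A × Word A)}

theorem presCon_of_vagnerRel {x y : Word A} (h : VagnerRel A x y) : presCon R x y :=
  ConGen.Rel.of _ _ (.inl (ConGen.Rel.of _ _ h))

theorem presCon_wordInv {x y : Word A} (h : presCon R x y) :
    presCon R (wordInv x) (wordInv y) := by
  have hxy : (x : Presented R) = y := (Con.eq _).2 h
  have hinv (w : Word A) : (w : Presented R) * (wordInv w : Word A) * w = w :=
    (Con.eq _).2 (presCon_of_vagnerRel (.inv_law w))
  have hcomm (v w : Word A) :
      (v : Presented R) * (wordInv v : Word A) * (w * (wordInv w : Word A)) =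
        w * (wordInv w : Word A) * (v * (wordInv v : Word A)) :=
    (Con.eq _).2 (presCon_of_vagnerRel (.comm_law v w))
  refine (Con.eq _).1 (eq_of_generalized_inverses (m := (x : Presented R)) (hinv x) ?_ ?_ ?_ ?_ ?_)
  · simpa only [wordInv_wordInv] using hinv (wordInv x)
  · simpa only [hxy] using hinv y
  · simpa only [hxy, wordInv_wordInv] using hinv (wordInv y)
  · simpa only [hxy] using hcomm x y
  · simpa only [hxy, wordInv_wordInv] using hcomm (wordInv x) (wordInv y)

instance inverseMonoidPresented : InverseMonoid (Presented R) where
  inv x := Con.liftOn x (fun w => ((wordInv w : Word A) : Presented R)) fun _ _ h =>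
    (Con.eq _).2 (presCon_wordInv h)
  inv_inv x := by
    induction x using Con.induction_on with
    | H w => exact congrArg _ (wordInv_wordInv w)
  mul_inv_rev x y := by
    induction x, y using Con.induction_on₂ with
    | H v w => exact congrArg _ (wordInv_mul v w)
  mul_inv_mul_self x := by
    induction x using Con.induction_on with
    | H w => exact (Con.eq _).2 (presCon_of_vagnerRel (.inv_law w))
  mul_inv_comm x y := by
    induction x, y using Con.induction_on₂ with
    | H v w => exact (Con.eq _).2 (presCon_of_vagnerRel (.comm_law v w))

theorem letter_inv (l : A × Bool) : letter R (l.1, !l.2) = (letter R l)⁻¹ := rfl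

variable {S : Type*} [InverseMonoid S]

/-- The value of a word over `A ∪ A⁻¹` in an inverse monoid, given the values of the letters. -/
def evalWord (f : A → S) : Word A →* S :=
  FreeMonoid.lift fun l => cond l.2 (f l.1) (f l.1)⁻¹

theorem InverseMonoid.inv_one : (1 : S)⁻¹ = 1 := by
  simpa only [one_mul, mul_one] using InverseMonoid.mul_inv_mul_self (1 : S)

theorem evalWord_wordInv (f : A → S) (w : Word A) : evalWord f (wordInv w) = (evalWord f w)⁻¹ := by
  induction w using FreeMonoid.inductionOn' with
  | one => exact InverseMonoid.inv_one.symm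
  | of_mul l w ih =>
    have hl : evalWord f (wordInv (FreeMonoid.of l)) = (evalWord f (FreeMonoid.of l))⁻¹ := by
      obtain ⟨a, _ | _⟩ := l
      exacts [(inv_inv _).symm, rfl]
    rw [wordInv_mul, map_mul, map_mul, InverseMonoid.mul_inv_rev, ih, hl]

theorem presCon_le_ker_evalWord {f : A → S}
    (hR : ∀ r ∈ R, evalWord f r.1 = evalWord f r.2) : presCon R ≤ Con.ker (evalWord f) := by
  refine Con.conGen_le.2 fun x y h => h.elim (fun h => ?_) fun h => hR _ h
  refine Con.conGen_le.2 (fun x y h => ?_) h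
  change evalWord f x = evalWord f y
  cases h with
  | inv_law w =>
    simp only [map_mul, evalWord_wordInv, InverseMonoid.mul_inv_mul_self]
  | comm_law u v => simp only [map_mul, evalWord_wordInv, mul_inv_comm]

/-- The universal property of `Inv⟨A | R⟩` among inverse monoids. -/
def presLift (f : A → S) (hR : ∀ r ∈ R, evalWord f r.1 = evalWord f r.2) : Presented R →* S :=
  (presCon R).lift (evalWord f) (presCon_le_ker_evalWord hR)

theorem evalWord_comp_letter {φ : Presented R →* S} (hφ : ∀ x, φ x⁻¹ = (φ x)⁻¹) (w : Word A) :
    evalWord (fun a => φ (letter R (a, true))) w = φ w := by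
  have hhom : evalWord (fun a => φ (letter R (a, true))) = φ.comp (presCon R).mk' := by
    refine FreeMonoid.hom_eq fun l => ?_
    obtain ⟨a, _ | _⟩ := l
    exacts [(hφ (letter R (a, true))).symm, rfl]
  exact DFunLike.congr_fun hhom w

end InverseMonoids

section WagnerPreston

open InverseMonoid (mul_inv_mul_self)

/-- The factors of `v`, that is, the elements above `v` in the `J`-order. -/
def factors {M : Type*} [Monoid M] (v : M) : Set M := {x | ∃ p q, v = p * x * q}

variable {M : Type*} [InverseMonoid M] {v s t x y : M}

theorem mul_mem_factors (hx : x ∈ factors v) (hs : s⁻¹ * s * x = x) : s * x ∈ factors v := by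
  obtain ⟨p, q, hv⟩ := hx
  refine ⟨p * s⁻¹, q, hv.trans ?_⟩
  rw [mul_assoc p s⁻¹, ← mul_assoc s⁻¹, hs]

theorem inv_mul_eq_of_mul_eq (h : s⁻¹ * s * x = x ∧ s * x = y) :
    s * s⁻¹ * y = y ∧ s⁻¹ * y = x := by
  obtain ⟨hx, rfl⟩ := h
  exact ⟨by rw [← mul_assoc, mul_inv_mul_self], by rwa [← mul_assoc]⟩

theorem mul_eq_iff_inv_mul_eq :
    (s⁻¹ * s * x = x ∧ s * x = y) ↔ (s * s⁻¹ * y = y ∧ s⁻¹ * y = x) :=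
  ⟨inv_mul_eq_of_mul_eq, fun h => by
    simpa only [inv_inv] using inv_mul_eq_of_mul_eq (s := s⁻¹) (by simpa only [inv_inv] using h)⟩

theorem mul_domain_iff :
    (s * t)⁻¹ * (s * t) * x = x ↔ t⁻¹ * t * x = x ∧ s⁻¹ * s * (t * x) = t * x := by
  constructor
  · intro h
    have hx : t⁻¹ * (s⁻¹ * s * (t * x)) = x := by
      simpa only [InverseMonoid.mul_inv_rev, mul_assoc] using h
    have ht : t⁻¹ * t * x = x := by
      rw [← hx, ← mul_assoc (t⁻¹ * t), inv_mul_inv_self]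
    refine ⟨ht, ?_⟩
    calc s⁻¹ * s * (t * x) = s⁻¹ * s * (t * t⁻¹) * (t * x) := by
          rw [← mul_assoc, mul_assoc _ _ (t * x), ← mul_assoc _ t x, mul_inv_mul_self, mul_assoc]
      _ = t * (t⁻¹ * (s⁻¹ * s * (t * x))) := by
          rw [inv_mul_mul_inv_comm]; simp only [mul_assoc]
      _ = t * x := by rw [hx]
  · rintro ⟨ht, hs⟩
    calc (s * t)⁻¹ * (s * t) * x = t⁻¹ * (s⁻¹ * s * (t * x)) := by
          rw [InverseMonoid.mul_inv_rev]; simp only [mul_assoc]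
      _ = x := by rw [hs, ← mul_assoc, ht]

open scoped Classical in
/-- The partial bijection `x ↦ s * x` of the set of factors of `v`, with domain
`{x | s⁻¹ * s * x = x}`. -/
noncomputable def factorAction (v s : M) : factors v ≃. factors v where
  toFun x := if h : s⁻¹ * s * x.1 = x.1 then some ⟨s * x.1, mul_mem_factors x.2 h⟩ else none
  invFun y := if h : s⁻¹⁻¹ * s⁻¹ * y.1 = y.1 then some ⟨s⁻¹ * y.1, mul_mem_factors y.2 h⟩ else none
  inv x y := by
    simp only [inv_inv, Option.dite_none_right_eq_some, Option.some.injEq,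
      Subtype.ext_iff, exists_prop]
    exact mul_eq_iff_inv_mul_eq.symm

theorem factorAction_eq_some_iff {x y : factors v} :
    factorAction v s x = some y ↔ s⁻¹ * s * x.1 = x.1 ∧ s * x.1 = y.1 := by
  simp only [factorAction, PEquiv.coe_mk, Option.dite_none_right_eq_some, Option.some.injEq,
    Subtype.ext_iff, exists_prop]

/-- The Wagner–Preston representation of an inverse monoid, restricted to the factors of `v`. -/
noncomputable def wagnerPreston (v : M) : M →* (factors v ≃. factors v) where
  toFun := factorAction v
  map_one' := PEquiv.ext fun x => Option.ext fun y => by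
    rw [factorAction_eq_some_iff, InverseMonoid.inv_one]
    simp only [one_mul, true_and]
    exact Subtype.ext_iff.symm.trans (Option.some_inj (a := x) (b := y)).symm
  map_mul' s t := PEquiv.ext fun x => Option.ext fun y => by
    rw [mul_apply_eq, Option.bind_eq_some_iff, factorAction_eq_some_iff, mul_domain_iff]
    simp only [factorAction_eq_some_iff]
    constructor
    · rintro ⟨⟨ht, hs⟩, hy⟩
      exact ⟨⟨t * x.1, mul_mem_factors x.2 ht⟩, ⟨ht, rfl⟩, hs, by rw [← hy, mul_assoc]⟩
    · rintro ⟨z, ⟨ht, hz⟩, hs, hy⟩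
      rw [← hz] at hs hy
      exact ⟨⟨ht, hs⟩, by rw [← hy, mul_assoc]⟩

theorem wagnerPreston_inv (v s : M) : wagnerPreston v s⁻¹ = (wagnerPreston v s)⁻¹ :=
  PEquiv.ext fun _ => rfl

theorem mul_inv_eq_of_wagnerPreston_eq (hs : s⁻¹ ∈ factors v)
    (h : wagnerPreston v s = wagnerPreston v t) : t⁻¹ * t * s⁻¹ = s⁻¹ ∧ t * s⁻¹ = s * s⁻¹ := by
  have hdef : factorAction v s ⟨s⁻¹, hs⟩ =
      some ⟨s * s⁻¹, mul_mem_factors hs (inv_mul_inv_self s)⟩ :=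
    factorAction_eq_some_iff.2 ⟨inv_mul_inv_self s, rfl⟩
  rw [show factorAction v s = factorAction v t from h] at hdef
  exact factorAction_eq_some_iff.1 hdef

theorem eq_of_wagnerPreston_eq (h : wagnerPreston v v = wagnerPreston v s) : v = s := by
  have hv : s * v⁻¹ * v = v := by
    have hmem : v⁻¹ ∈ factors v := ⟨v, v, (mul_inv_mul_self v).symm⟩
    rw [(mul_inv_eq_of_wagnerPreston_eq hmem h).2, mul_inv_mul_self]
  have hs : v * s⁻¹ * s = s := by
    have hmem : s⁻¹ ∈ factors v :=
      ⟨s, s * v⁻¹ * v, by simp only [← mul_assoc]; rw [mul_inv_mul_self, hv]⟩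
    rw [(mul_inv_eq_of_wagnerPreston_eq hmem h.symm).2, mul_inv_mul_self]
  calc v = v * s⁻¹ * s * v⁻¹ * v := by rw [hs, hv]
    _ = v * (s⁻¹ * s * (v⁻¹ * v)) := by simp only [mul_assoc]
    _ = v * v⁻¹ * v * s⁻¹ * s := by rw [inv_mul_comm]; simp only [mul_assoc]
    _ = s := by rw [mul_inv_mul_self, hs]

end WagnerPreston

section Tables

theorem exists_lookup_eq {κ β : Type*} [BEq κ] [LawfulBEq κ] (g : κ → Option β)
    (hg : {k | g k ≠ none}.Finite) : ∃ t : List (κ × β), ∀ k, t.lookup k = g k := by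
  classical
  suffices h : ∀ (s : Finset κ) (g : κ → Option β), (∀ k ∉ s, g k = none) →
      ∃ t : List (κ × β), ∀ k, t.lookup k = g k from
    h hg.toFinset g fun k hk => by simpa using hk
  intro s
  induction s using Finset.induction_on with
  | empty => exact fun g hg => ⟨[], fun k => (hg k (Finset.notMem_empty k)).symm⟩
  | insert j s _ ih =>
    intro g hg
    obtain ⟨t, ht⟩ := ih (Function.update g j none) fun k hk => by
      by_cases hkj : k = j
      · rw [hkj, Function.update_self]
      · rw [Function.update_of_ne hkj, hg k (by simp [hkj, hk])]
    cases hj : g j with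
    | none => exact ⟨t, fun k => by rw [ht, ← hj, Function.update_eq_self]⟩
    | some b =>
      refine ⟨(j, b) :: t, fun k => ?_⟩
      rw [List.lookup_cons, ht]
      by_cases hkj : k = j
      · simp [hkj, hj]
      · rw [beq_false_of_ne hkj, Function.update_of_ne hkj]

theorem primrec_lookup {κ β : Type*} [Primcodable κ] [Primcodable β] [BEq κ] [LawfulBEq κ] :
    Primrec₂ (List.lookup : κ → List (κ × β) → Option β) := by
  classical
  convert Primrec.listLookup (α := κ) (β := β)

/-- A finite inverse automaton over `A ∪ A⁻¹`, encoded by its number `n` of states and a list of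
transitions `((l, p), q)`. Only the transitions between states less than `n` that also occur
reversed count, so that every table defines partial bijections. -/
abbrev TransitionTable (A : Type u) : Type u := ℕ × List (((A × Bool) × ℕ) × ℕ)

namespace TransitionTable

variable {A : Type u} [DecidableEq A]

/-- The transition out of the state `p` labelled by `l`. -/
def next (c : TransitionTable A) (l : A × Bool) (p : ℕ) : Option ℕ :=
  (c.2.lookup (l, p)).bind fun q =>
    if q < c.1 ∧ c.2.lookup ((l.1, !l.2), q) = some p then some q else none

theorem next_eq_some_iff {c : TransitionTable A} {l : A × Bool} {p q : ℕ} :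
    c.next l p = some q ↔
      q < c.1 ∧ c.2.lookup (l, p) = some q ∧ c.2.lookup ((l.1, !l.2), q) = some p := by
  simp only [next, Option.bind_eq_some_iff, Option.ite_none_right_eq_some, Option.some.injEq]
  grind

/-- The restriction of `next` to the states. -/
def step (c : TransitionTable A) (l : A × Bool) (p : Fin c.1) : Option (Fin c.1) :=
  (c.next l p).pmap (fun q hq => ⟨q, hq⟩) fun _ hq => (next_eq_some_iff.1 hq).1

theorem map_val_step (c : TransitionTable A) (l : A × Bool) (p : Fin c.1) :
    (c.step l p).map Fin.val = c.next l p := by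
  rw [step, Option.map_pmap]; simp

theorem step_eq_some_iff {c : TransitionTable A} {l : A × Bool} {p q : Fin c.1} :
    c.step l p = some q ↔
      c.2.lookup (l, p.1) = some q.1 ∧ c.2.lookup ((l.1, !l.2), q.1) = some p.1 := by
  rw [← (Option.map_injective Fin.val_injective).eq_iff, map_val_step, Option.map_some,
    next_eq_some_iff]
  exact and_iff_right q.2

/-- The action of the letter `a` on the states. -/
def action (c : TransitionTable A) (a : A) : Fin c.1 ≃. Fin c.1 where
  toFun := c.step (a, true)
  invFun := c.step (a, false)
  inv p q := by
    simp only [step_eq_some_iff, Bool.not_true, Bool.not_false, and_comm]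

/-- The state reached by reading a word from right to left. -/
def run (c : TransitionTable A) (w : Word A) (p : ℕ) : Option ℕ :=
  (FreeMonoid.toList w).foldr (fun l o => o.bind (c.next l)) (some p)

theorem map_val_evalWord_action (c : TransitionTable A) (w : Word A) (p : Fin c.1) :
    (evalWord c.action w p).map Fin.val = c.run w p := by
  have hletter (l : A × Bool) (q : Fin c.1) : evalWord c.action (.of l) q = c.step l q := by
    obtain ⟨a, _ | _⟩ := l <;> rfl
  induction w using FreeMonoid.inductionOn' with
  | one => rfl
  | of_mul l w ih =>
    have hrun : c.run (.of l * w) p = (c.run w p).bind (c.next l) := rfl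
    rw [hrun, ← ih, map_mul, mul_apply_eq, Option.map_bind, Option.bind_map]
    refine congrArg _ (funext fun q => ?_)
    simp only [Function.comp_apply, hletter, map_val_step]

theorem evalWord_action_eq_iff {c : TransitionTable A} {v w : Word A} :
    evalWord c.action v = evalWord c.action w ↔ ∀ p ∈ List.range c.1, c.run v p = c.run w p := by
  simp only [List.mem_range]
  constructor
  · intro h p hp
    rw [← map_val_evalWord_action c v ⟨p, hp⟩, ← map_val_evalWord_action c w ⟨p, hp⟩, h]
  · refine fun h => PEquiv.ext fun p => Option.map_injective Fin.val_injective ?_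
    rw [map_val_evalWord_action, map_val_evalWord_action, h p p.2]

theorem exists_action_eq [Finite A] {n : ℕ} (f : A → (Fin n ≃. Fin n)) :
    ∃ t, action (n, t) = f := by
  let g (k : (A × Bool) × ℕ) : Option ℕ :=
    if hp : k.2 < n then (evalWord f (.of k.1) ⟨k.2, hp⟩).map Fin.val else none
  have hg (l : A × Bool) (p q : Fin n) :
      g (l, p.1) = some q.1 ↔ evalWord f (.of l) p = some q := by
    simp only [g, p.2, dite_true, Fin.eta]
    exact (Option.map_injective Fin.val_injective).eq_iff (b := some q)
  obtain ⟨t, ht⟩ := exists_lookup_eq g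
    (((Set.finite_univ (α := A × Bool)).prod (Set.finite_lt_nat n)).subset fun k hk => by
      simp only [g] at hk
      grind)
  refine ⟨t, funext fun a => PEquiv.ext fun p => Option.ext fun q => ?_⟩
  have hsymm : evalWord f (.of (a, false)) q = some p ↔ evalWord f (.of (a, true)) p = some q :=
    PEquiv.eq_some_iff (f a)
  refine step_eq_some_iff.trans ?_
  change t.lookup ((a, true), p.1) = some q.1 ∧ t.lookup ((a, false), q.1) = some p.1 ↔
    f a p = some q
  rw [ht, ht, hg, hg, hsymm]
  exact and_self_iff

variable {α : Type*} [Primcodable A] [Primcodable α] {c : α → TransitionTable A}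

theorem primrec_next {l : α → A × Bool} {p : α → ℕ} (hc : Primrec c) (hl : Primrec l)
    (hp : Primrec p) : Primrec fun x => (c x).next (l x) (p x) := by
  have hentries : Primrec fun y : α × ℕ => (c y.1).2 := .comp .snd (.comp hc .fst)
  have hback : Primrec fun y : α × ℕ => (c y.1).2.lookup (((l y.1).1, !(l y.1).2), y.2) :=
    primrec_lookup.comp (Primrec.pair (Primrec.pair (.comp .fst (.comp hl .fst))
      (Primrec.not.comp (.comp .snd (.comp hl .fst)))) .snd) hentries
  refine Primrec.option_bind (primrec_lookup.comp (Primrec.pair hl hp) (.comp .snd hc)) ?_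
  exact Primrec.ite ((Primrec.nat_lt.comp .snd (.comp .fst (.comp hc .fst))).and
    (Primrec.eq.comp hback (Primrec.option_some.comp (.comp hp .fst))))
    (Primrec.option_some.comp .snd) (.const none)

theorem primrec_run {w : α → Word A} {p : α → ℕ} (hc : Primrec c) (hw : Primrec w)
    (hp : Primrec p) : Primrec fun x => (c x).run (w x) (p x) := by
  have hnext : Primrec₂ fun (x : α × (A × Bool) × Option ℕ) q => (c x.1).next x.2.1 q :=
    primrec_next (.comp hc (.comp .fst .fst)) (.comp .fst (.comp .snd .fst)) .snd
  have hbind : Primrec₂ fun (x : α) (y : (A × Bool) × Option ℕ) => y.2.bind ((c x).next y.1) :=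
    (Primrec.option_bind (.comp .snd .snd) hnext).to₂
  exact Primrec.list_foldr hw (Primrec.option_some.comp hp) hbind

theorem primrecPred_evalWord_action_eq {v w : α → Word A} (hc : Primrec c) (hv : Primrec v)
    (hw : Primrec w) :
    PrimrecPred fun x => evalWord (c x).action (v x) = evalWord (c x).action (w x) := by
  have hrun : PrimrecRel fun (p : ℕ) (x : α) => (c x).run (v x) p = (c x).run (w x) p :=
    Primrec.eq.comp (primrec_run (.comp hc .snd) (.comp hv .snd) .fst)
      (primrec_run (.comp hc .snd) (.comp hw .snd) .fst)
  exact (hrun.forall_mem_list.comp (Primrec.list_range.comp (.comp .fst hc)) .id).of_eq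
    fun x => evalWord_action_eq_iff.symm

end TransitionTable
end Tables

section Separability

/-- Transport of partial bijections along a bijection. -/
def conjPEquiv {σ τ : Type*} (e : σ ≃ τ) : (σ ≃. σ) →* (τ ≃. τ) where
  toFun f := (e.symm.toPEquiv.trans f).trans e.toPEquiv
  map_one' := by
    change (e.symm.toPEquiv.trans (PEquiv.refl σ)).trans e.toPEquiv = PEquiv.refl τ
    rw [PEquiv.trans_refl, ← Equiv.toPEquiv_trans, e.symm_trans_self, Equiv.toPEquiv_refl]
  map_mul' f g := by
    have he : e.toPEquiv.trans e.symm.toPEquiv = PEquiv.refl σ := by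
      rw [← Equiv.toPEquiv_trans, e.self_trans_symm, Equiv.toPEquiv_refl]
    change (e.symm.toPEquiv.trans (g.trans f)).trans e.toPEquiv = ((e.symm.toPEquiv.trans g).trans
      e.toPEquiv).trans ((e.symm.toPEquiv.trans f).trans e.toPEquiv)
    simp only [PEquiv.trans_assoc]
    rw [← PEquiv.trans_assoc e.toPEquiv, he, PEquiv.refl_trans]

theorem conjPEquiv_inv {σ τ : Type*} (e : σ ≃ τ) (f : σ ≃. σ) :
    conjPEquiv e f⁻¹ = (conjPEquiv e f)⁻¹ := by
  change _ = ((e.symm.toPEquiv.trans f).trans e.toPEquiv).symm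
  rw [PEquiv.symm_trans_rev, PEquiv.symm_trans_rev, ← PEquiv.trans_assoc]
  rfl

theorem conjPEquiv_injective {σ τ : Type*} (e : σ ≃ τ) : Function.Injective (conjPEquiv e) := by
  refine Function.LeftInverse.injective (g := conjPEquiv e.symm) fun f => ?_
  have he : e.toPEquiv.trans e.symm.toPEquiv = PEquiv.refl σ := by
    rw [← Equiv.toPEquiv_trans, e.self_trans_symm, Equiv.toPEquiv_refl]
  change (e.toPEquiv.trans ((e.symm.toPEquiv.trans f).trans e.toPEquiv)).trans e.symm.toPEquiv = f
  simp only [PEquiv.trans_assoc, he, PEquiv.trans_refl]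
  rw [← PEquiv.trans_assoc, he, PEquiv.refl_trans]

theorem finite_quotient_ker {M S : Type*} [Monoid M] [Monoid S] [Finite S] (φ : M →* S) :
    Finite (Con.ker φ).Quotient :=
  Finite.of_injective _ (Con.kerLift_injective φ)

instance finitePEquiv {σ : Type*} [Finite σ] : Finite (σ ≃. σ) :=
  Finite.of_injective _ DFunLike.coe_injective

variable {A : Type u} [Finite A] {R : Set (Word A × Word A)}

theorem exists_action_separating [DecidableEq A] {v : Presented R} (hv : (factors v).Finite) :
    ∃ (c : TransitionTable A) (hc : ∀ r ∈ R, evalWord c.action r.1 = evalWord c.action r.2),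
      ∀ x, presLift c.action hc v = presLift c.action hc x → v = x := by
  have := hv.to_subtype
  obtain ⟨n, ⟨e⟩⟩ := Finite.exists_equiv_fin (factors v)
  let φ : Presented R →* (Fin n ≃. Fin n) := (conjPEquiv e).comp (wagnerPreston v)
  have hφ (x) : φ x⁻¹ = (φ x)⁻¹ := by
    simp only [φ, MonoidHom.comp_apply, wagnerPreston_inv, conjPEquiv_inv]
  obtain ⟨t, ht⟩ := TransitionTable.exists_action_eq fun a => φ (letter R (a, true))
  have heval (w : Word A) : evalWord (TransitionTable.action (n, t)) w = φ w := by
    rw [ht]; exact evalWord_comp_letter hφ w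
  refine ⟨(n, t), fun r hr => ?_, fun x hx => ?_⟩
  · rw [heval, heval, (Con.eq _).2 (ConGen.Rel.of _ _ (.inr hr))]
  · induction v, x using Con.induction_on₂ with
    | H v x =>
      have hvx : φ v = φ x := (heval v).symm.trans (hx.trans (heval x))
      exact eq_of_wagnerPreston_eq (conjPEquiv_injective e hvx)

theorem effectivelyCompletelySeparable_letter [Primcodable A] (hR : R.Finite)
    (hJ : FiniteJAbove (Presented R)) : EffectivelyCompletelySeparable (letter R) := by
  classical
  have := hR.to_subtype
  have hmodel : PrimrecPred fun c : TransitionTable A =>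
      ∀ r : R, evalWord c.action r.1.1 = evalWord c.action r.1.2 :=
    primrecPred_forall fun r =>
      TransitionTable.primrecPred_evalWord_action_eq .id (.const r.1.1) (.const r.1.2)
  let Model := {c : TransitionTable A // ∀ r : R, evalWord c.action r.1.1 = evalWord c.action r.1.2}
  let _ : Primcodable Model := Primcodable.subtype hmodel
  have hval : Primrec (Subtype.val : Model → TransitionTable A) :=
    Primrec.subtype_val (hp := hmodel)
  let lift (c : Model) := presLift c.1.action fun r hr => c.2 ⟨r, hr⟩
  refine effectivelyCompletelySeparable_of_codes (fun c => Con.ker (lift c))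
    (fun c => finite_quotient_ker _) (fun v => ?_) ?_
  · obtain ⟨c, hc, hsep⟩ := exists_action_separating (hJ v)
    exact ⟨⟨c, fun r => hc r.1 r.2⟩, hsep⟩
  · have hword : Primrec (FreeMonoid.ofList : List (A × Bool) → Word A) := .id
    have hv := hword.comp (Primrec.fst.comp (Primrec.snd (α := Model) (β := _ × List (A × Bool))))
    have hw := hword.comp (Primrec.snd.comp (Primrec.snd (α := Model) (β := List (A × Bool) × _)))
    refine (TransitionTable.primrecPred_evalWord_action_eq (hval.comp .fst) hv hw).of_eq fun p => ?_
    simp only [prod_map_letter]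
    rfl

end Separability

section DirectProducts

theorem exists_primcodable (α : Type*) [Finite α] : Nonempty (Primcodable α) := by
  obtain ⟨n, ⟨e⟩⟩ := Finite.exists_equiv_fin α
  exact ⟨Primcodable.ofEquiv _ e⟩

variable {A : Type u} [Finite A] {R : Set (Word A × Word A)} {α : Type*} [Primcodable α] [Finite α]

theorem semidecidableEq_presented (hR : R.Finite) (g : α → Presented R) : SemidecidableEq g := by
  obtain ⟨_⟩ := exists_primcodable A
  obtain ⟨u, hu⟩ := exists_words g
  exact (semidecidableEq_letter (primrecPred_mem_of_finite hR).computablePred.to_re).of_words u hu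

theorem effectivelyCompletelySeparable_presented (hR : R.Finite) (hJ : FiniteJAbove (Presented R))
    (g : α → Presented R) : EffectivelyCompletelySeparable g := by
  obtain ⟨_⟩ := exists_primcodable A
  obtain ⟨u, hu⟩ := exists_words g
  exact (effectivelyCompletelySeparable_letter hR hJ).of_words u hu

theorem decidableMembership_pi_closure {ι : Type u} [Finite ι] {A : ι → Type u} [∀ i, Finite (A i)]
    {R : ∀ i, Set (Word (A i) × Word (A i))} (hR : ∀ i, (R i).Finite)
    (hJ : ∀ i, FiniteJAbove (Presented (R i))) {F : Set (∀ i, Presented (R i))} (hF : F.Finite) :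
    DecidableMembership (∀ i, Presented (R i)) (Submonoid.closure F) :=
  decidableMembership_closure
    (fun f => .pi fun i => semidecidableEq_presented (hR i) fun a => f a i)
    (fun f => .pi fun i => effectivelyCompletelySeparable_presented (hR i) (hJ i) fun a => f a i) hF

end DirectProducts

section MunnTrees

open scoped Pointwise
open FreeGroup (mk invRev)

theorem mk_mul_wordInv {A : Type u} (w : Word A) : mk (w * wordInv w).toList = 1 := by
  change mk (w.toList ++ invRev w.toList) = 1
  rw [← FreeGroup.mul_mk, ← FreeGroup.inv_mk, mul_inv_cancel]

variable {A : Type u} [DecidableEq A]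

/-- The vertex set of the Munn tree of a word: the elements of the free group represented by its
suffixes. -/
def munnTree : List (A × Bool) → Finset (FreeGroup A)
  | [] => {1}
  | l :: w => {mk (l :: w)} ∪ munnTree w

theorem mk_mem_munnTree (w : List (A × Bool)) : mk w ∈ munnTree w := by
  cases w with
  | nil => exact Finset.mem_singleton_self _
  | cons l w => exact Finset.mem_union_left _ (Finset.mem_singleton_self _)

theorem munnTree_append (v w : List (A × Bool)) :
    munnTree (v ++ w) = munnTree v * {mk w} ∪ munnTree w := by
  induction v with
  | nil =>
    rw [munnTree, Finset.singleton_mul_singleton, one_mul, List.nil_append, Finset.union_eq_right.2]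
    exact Finset.singleton_subset_iff.2 (mk_mem_munnTree w)
  | cons l v ih =>
    rw [List.cons_append, munnTree, ih, munnTree, Finset.union_mul, Finset.singleton_mul_singleton,
      FreeGroup.mul_mk, List.cons_append, Finset.union_assoc]

theorem munnTree_invRev (w : List (A × Bool)) :
    munnTree (invRev w) = munnTree w * {(mk w)⁻¹} := by
  induction w with
  | nil =>
    rw [munnTree, ← FreeGroup.one_eq_mk, inv_one, Finset.singleton_mul_singleton, one_mul]
    rfl
  | cons l w ih =>
    have hinv : invRev (l :: w) = invRev w ++ [(l.1, !l.2)] := by simp [invRev]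
    have hmk : (mk (l :: w))⁻¹ = (mk w)⁻¹ * mk [(l.1, !l.2)] := by
      rw [FreeGroup.inv_mk, hinv, ← FreeGroup.mul_mk, FreeGroup.inv_mk]
    have hmem : mk [(l.1, !l.2)] ∈ munnTree w * {(mk w)⁻¹ * mk [(l.1, !l.2)]} :=
      Finset.mem_mul.2 ⟨_, mk_mem_munnTree w, _, Finset.mem_singleton_self _,
        mul_inv_cancel_left _ _⟩
    rw [hinv, munnTree_append, ih, munnTree, munnTree, munnTree, Finset.union_mul,
      Finset.singleton_mul_singleton, mul_inv_cancel, hmk, mul_assoc,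
      Finset.singleton_mul_singleton, ← Finset.union_assoc,
      Finset.union_eq_left.2 (Finset.singleton_subset_iff.2 hmem),
      Finset.union_comm]

/-- Munn's congruence: two words are related if they represent the same element of the free group
and have the same Munn tree. -/
def munnCon (A : Type u) [DecidableEq A] : Con (Word A) where
  r v w := mk v.toList = mk w.toList ∧ munnTree v.toList = munnTree w.toList
  iseqv := ⟨fun _ => ⟨rfl, rfl⟩, fun h => ⟨h.1.symm, h.2.symm⟩,
    fun h h' => ⟨h.1.trans h'.1, h.2.trans h'.2⟩⟩
  mul' h h' := by
    simp only [FreeMonoid.toList_mul, ← FreeGroup.mul_mk, munnTree_append, h.1, h.2, h'.1, h'.2,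
      and_self]

theorem munnTree_mul_wordInv (w : Word A) :
    munnTree (w * wordInv w).toList = munnTree w.toList * {(mk w.toList)⁻¹} := by
  change munnTree (w.toList ++ invRev w.toList) = _
  rw [munnTree_append, munnTree_invRev, ← FreeGroup.inv_mk, Finset.union_self]

theorem vagnerCon_le_munnCon : vagnerCon A ≤ munnCon A := by
  refine Con.conGen_le.2 fun v w h => ?_
  cases h with
  | inv_law w =>
    constructor
    · rw [FreeMonoid.toList_mul, ← FreeGroup.mul_mk, mk_mul_wordInv, one_mul]
    · rw [FreeMonoid.toList_mul, munnTree_append, munnTree_mul_wordInv, mul_assoc,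
        Finset.singleton_mul_singleton, inv_mul_cancel, Finset.singleton_one, mul_one,
        Finset.union_self]
  | comm_law x y =>
    constructor
    · simp only [FreeMonoid.toList_mul (x * _), FreeMonoid.toList_mul (y * _), ← FreeGroup.mul_mk,
        mk_mul_wordInv]
    · simp only [FreeMonoid.toList_mul (x * _), FreeMonoid.toList_mul (y * _), munnTree_append,
        mk_mul_wordInv, Finset.singleton_one, mul_one]
      exact Finset.union_comm _ _

theorem munnTree_subset_of_eq_mul {v p x q : Word A} (h : munnCon A v (p * x * q)) :
    munnTree x.toList ⊆ munnTree v.toList * (munnTree v.toList)⁻¹ := by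
  have hv : munnTree v.toList = munnTree (p * x).toList * {mk q.toList} ∪ munnTree q.toList :=
    h.2.trans (munnTree_append _ _)
  have hpx : munnTree (p * x).toList = munnTree p.toList * {mk x.toList} ∪ munnTree x.toList :=
    munnTree_append _ _
  intro g hg
  have hq : mk q.toList ∈ munnTree v.toList := hv ▸ Finset.mem_union_right _ (mk_mem_munnTree _)
  have hgq : g * mk q.toList ∈ munnTree v.toList :=
    hv ▸ Finset.mem_union_left _ (Finset.mul_mem_mul (hpx ▸ Finset.mem_union_right _ hg)
      (Finset.mem_singleton_self _))
  rw [← mul_inv_cancel_right g (mk q.toList)]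
  exact Finset.mul_mem_mul hgq (Finset.inv_mem_inv hq)

end MunnTrees

section NormalForm

open scoped Pointwise
open FreeGroup (mk)

variable {A : Type u} [DecidableEq A] {R : Set (Word A × Word A)}

theorem toWord_mk_cons (l : A × Bool) (w : List (A × Bool)) :
    (mk (l :: w)).toWord = l :: (mk w).toWord ∨
      (mk w).toWord = (l.1, !l.2) :: (mk (l :: w)).toWord := by
  simp only [FreeGroup.toWord_mk, FreeGroup.reduce.cons]
  cases hw : FreeGroup.reduce w with
  | nil => exact .inl rfl
  | cons l' w' =>
    by_cases hl : l.1 = l'.1 ∧ l.2 = !l'.2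
    · right
      simp only [hl, and_self, if_true, Bool.not_not]
    · left
      simp only [hl, if_false]

/-- The element of `Inv⟨A | R⟩` represented by the reduced word of an element of the free group. -/
def reduced (R : Set (Word A × Word A)) (g : FreeGroup A) : Presented R :=
  (g.toWord.map (letter R)).prod

/-- The idempotent `r⁻¹ * r`, where `r` is represented by the reduced word of `g`; its Munn tree is
the path from `1` to `g`. -/
def pathIdempotent (R : Set (Word A × Word A)) (g : FreeGroup A) : Presented R :=
  (reduced R g)⁻¹ * reduced R g

theorem pairwise_commute_pathIdempotent (T : Set (FreeGroup A)) :
    T.Pairwise (Function.onFun Commute (pathIdempotent R)) :=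
  fun _ _ _ _ _ => inv_mul_comm _ _

/-- The idempotent with Munn tree `T`, for a set `T` of vertices closed under taking suffixes. -/
def treeIdempotent (R : Set (Word A × Word A)) (T : Finset (FreeGroup A)) : Presented R :=
  T.noncommProd (pathIdempotent R) (pairwise_commute_pathIdempotent _)

theorem pathIdempotent_mul_self (g : FreeGroup A) :
    pathIdempotent R g * pathIdempotent R g = pathIdempotent R g := by
  rw [pathIdempotent, ← mul_assoc, inv_mul_inv_self]

theorem reduced_mul_pathIdempotent (g : FreeGroup A) :
    reduced R g * pathIdempotent R g = reduced R g := by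
  rw [pathIdempotent, ← mul_assoc, InverseMonoid.mul_inv_mul_self]

theorem pathIdempotent_mul_treeIdempotent {g : FreeGroup A} {T : Finset (FreeGroup A)}
    (hg : g ∈ T) : pathIdempotent R g * treeIdempotent R T = treeIdempotent R T := by
  rw [treeIdempotent, ← Finset.mul_noncommProd_erase T hg, ← mul_assoc, pathIdempotent_mul_self]

theorem treeIdempotent_union_singleton (g : FreeGroup A) (T : Finset (FreeGroup A)) :
    treeIdempotent R ({g} ∪ T) = pathIdempotent R g * treeIdempotent R T := by
  by_cases hg : g ∈ T
  · rw [Finset.union_eq_right.2 (Finset.singleton_subset_iff.2 hg),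
      pathIdempotent_mul_treeIdempotent hg]
  · exact Finset.noncommProd_insert_of_notMem T g _ _ hg

theorem letter_mul_reduced (l : A × Bool) (w : List (A × Bool)) :
    letter R l * reduced R (mk w) = reduced R (mk (l :: w)) * pathIdempotent R (mk w) := by
  rcases toWord_mk_cons l w with h | h
  · have hred : reduced R (mk (l :: w)) = letter R l * reduced R (mk w) := by
      rw [reduced, h, List.map_cons, List.prod_cons]; rfl
    rw [hred, mul_assoc, reduced_mul_pathIdempotent]
  · have hred : reduced R (mk w) = (letter R l)⁻¹ * reduced R (mk (l :: w)) := by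
      rw [reduced, h, List.map_cons, List.prod_cons, letter_inv]; rfl
    rw [pathIdempotent, hred, mul_inv_mul_eq]

theorem prod_map_letter_eq_reduced_mul_treeIdempotent (w : List (A × Bool)) :
    (w.map (letter R)).prod = reduced R (mk w) * treeIdempotent R (munnTree w) := by
  induction w with
  | nil =>
    rw [munnTree, treeIdempotent, Finset.noncommProd_singleton, ← FreeGroup.one_eq_mk,
      reduced_mul_pathIdempotent]
    rfl
  | cons l w ih =>
    rw [List.map_cons, List.prod_cons, ih, munnTree, treeIdempotent_union_singleton, ← mul_assoc,
      letter_mul_reduced, mul_assoc, pathIdempotent_mul_treeIdempotent (mk_mem_munnTree w),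
      ← mul_assoc, reduced_mul_pathIdempotent]

theorem finite_setOf_munnTree_subset (V : Finset (FreeGroup A)) :
    {x : Presented R | ∃ w : Word A, ↑w = x ∧ munnTree w.toList ⊆ V}.Finite := by
  refine ((V ×ˢ V.powerset).finite_toSet.image fun gT =>
    reduced R gT.1 * treeIdempotent R gT.2).subset ?_
  rintro _ ⟨w, rfl, hw⟩
  refine ⟨(mk w.toList, munnTree w.toList), Finset.mem_coe.2 (Finset.mem_product.2
    ⟨hw (mk_mem_munnTree _), Finset.mem_powerset.2 hw⟩), ?_⟩
  exact (prod_map_letter_eq_reduced_mul_treeIdempotent _).symm.trans (prod_map_letter R _)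

theorem presCon_empty_le_munnCon : presCon (∅ : Set (Word A × Word A)) ≤ munnCon A :=
  Con.conGen_le.2 fun _ _ h => h.elim (fun h => vagnerCon_le_munnCon h) fun h => h.elim

theorem finiteJAbove_presented_empty {A : Type u} :
    FiniteJAbove (Presented (∅ : Set (Word A × Word A))) := by
  classical
  intro v
  induction v using Con.induction_on with
  | H v =>
    refine (finite_setOf_munnTree_subset (munnTree v.toList * (munnTree v.toList)⁻¹)).subset ?_
    rintro x ⟨p, q, h⟩
    obtain ⟨p, rfl⟩ := Con.mk'_surjective p
    obtain ⟨x, rfl⟩ := Con.mk'_surjective x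
    obtain ⟨q, rfl⟩ := Con.mk'_surjective q
    exact ⟨x, rfl, munnTree_subset_of_eq_mul (presCon_empty_le_munnCon ((Con.eq _).1 h))⟩

end NormalForm

end InvPres

theorem corollary4p6 {A : Type u} [Finite A] [DecidableEq A] :
    (∀ R : Set (InvPres.Word A × InvPres.Word A), R.Finite →
      (∀ a : A, InvPres.FiniteJAbove (InvPres.Component R a)) →
      InvPres.DecidableMembership ((a : A) → InvPres.Component R a)
        (Set.range (InvPres.eraser R))) ∧
    InvPres.DecidableMembership
      ((a : A) → InvPres.Component (∅ : Set (InvPres.Word A × InvPres.Word A)) a)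
      (Set.range (InvPres.eraser (∅ : Set (InvPres.Word A × InvPres.Word A)))) := by
  have decidable_range (R : Set (InvPres.Word A × InvPres.Word A)) (hR : R.Finite)
      (hJ : ∀ a : A, InvPres.FiniteJAbove (InvPres.Component R a)) :
      InvPres.DecidableMembership ((a : A) → InvPres.Component R a)
        (Set.range (InvPres.eraser R)) := by
    rw [InvPres.range_eq_closure_letter]
    exact InvPres.decidableMembership_pi_closure (fun a => hR.image _) hJ (Set.finite_range _)
  refine ⟨decidable_range, decidable_range ∅ Set.finite_empty fun a => ?_⟩
  have herased : InvPres.erasedRel (∅ : Set (InvPres.Word A × InvPres.Word A)) a = ∅ :=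
    Set.image_empty _
  change InvPres.FiniteJAbove (InvPres.Presented (InvPres.erasedRel ∅ a))
  rw [herased]
  exact InvPres.finiteJAbove_presented_empty
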